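/- Let $G$ be a finite group. For $H\le G$ let $A(H)$ be the Burnside ring of $H$, that is, the ring of formal differences of isomorphism classes of finite $H$-sets, with addition given by disjoint union and multiplication by Cartesian product. For $I\le H$ and $p$ a prime or $0$, let $\varphi^I_{H,p}\colon A(H)\to\mathbb Z/p\mathbb Z$ be the ring homomorphism that sends a finite $H$-set $X$ to the class of $|X^I|$, the number of its $I$-fixed points (with $\mathbb Z/0\mathbb Z=\mathbb Z$). The Burnside Tambara functor $\underline A_G$ has $\underline A_G(G/H)=A(H)$. For $C\le G$ and $p$ a prime or $0$, let $\mathfrak p_{C,p}$ be the family of ideals $$\mathfrak p_{C,p}(G/H)=\bigcap_{\substack{I\le H,\\ g^{-1}Ig\le C\text{ for some }g\in G}}\ker\varphi^I_{H,p}\ \subseteq\ \underline A_G(G/H)\qquad(H\le G).$$ Containment of such families is understood levelwise: $\mathfrak p\subseteq\mathfrak q$ means $\mathfrak p(G/L)\subseteq\mathfrak q(G/L)$ for all $L\le G$, and $\subsetneq$ means $\subseteq$ and not equal. For a prime $p$ and $H\le G$, let $O^p(H)$ be the intersection of all normal subgroups of $H$ whose index in $H$ is a power of $p$ (including $p^0=1$).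 **Theorem.** Let $G$ be a finite abelian group, let $H,K\le G$, and let $p,q$ be primes. Then: (i) $\mathfrak p_{H,0}\subseteq\mathfrak p_{K,0}$ if and only if $K\le H$. (ii) $\mathfrak p_{H,0}\subsetneq\mathfrak p_{H,p}$, and $\mathfrak p_{H,p}\not\subseteq\mathfrak p_{K,0}$. (iii) $\mathfrak p_{H,p}\subseteq\mathfrak p_{K,q}$ if and only if $p=q$ and $O^p(K)\le O^p(H)$. -/

import Mathlib

namespace BurnsideTambara

universe u

/-! ### The ring completion of a commutative semiring -/

section Completion

open Algebra (GrothendieckAddGroup)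

variable {S : Type u} [CommSemiring S]

theorem lift_of {A : Type*} [AddCommGroup A] (f : S →+ A) (a : S) :
    GrothendieckAddGroup.lift f (GrothendieckAddGroup.of a) = f a :=
  DFunLike.congr_fun (GrothendieckAddGroup.lift.symm_apply_apply f) a

/-- Every element of the Grothendieck group is a formal difference. -/
theorem exists_sub (x : GrothendieckAddGroup S) :
    ∃ a b : S, x = GrothendieckAddGroup.of a - GrothendieckAddGroup.of b := by
  induction x using AddLocalization.ind with
  | H y =>
    obtain ⟨a, b⟩ := y
    refine ⟨a, b, ?_⟩
    simp only [GrothendieckAddGroup.of, AddLocalization.mk_eq_addMonoidOf_mk']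
    rw [eq_sub_iff_add_eq]
    exact (AddLocalization.addMonoidOf ⊤).mk'_spec a b

/-- The biadditive extension to the Grothendieck group of the multiplication of a commutative
semiring: `[a] * [b] = [a * b]` for `a b : S`. -/
noncomputable def completionMul :
    GrothendieckAddGroup S →+ GrothendieckAddGroup S →+ GrothendieckAddGroup S :=
  GrothendieckAddGroup.lift
    { toFun := fun a =>
        GrothendieckAddGroup.lift (GrothendieckAddGroup.of.comp (AddMonoidHom.mulLeft a))
      map_zero' := by
        refine DFunLike.ext _ _ fun x => ?_
        obtain ⟨b, c, rfl⟩ := exists_sub x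
        simp only [map_sub, lift_of]
        simp
      map_add' := fun a a' => by
        refine DFunLike.ext _ _ fun x => ?_
        obtain ⟨b, c, rfl⟩ := exists_sub x
        simp only [map_sub, AddMonoidHom.add_apply, lift_of]
        simp only [AddMonoidHom.comp_apply, AddMonoidHom.coe_mulLeft, add_mul, map_add] }

theorem completionMul_of (a b : S) :
    completionMul (GrothendieckAddGroup.of a) (GrothendieckAddGroup.of b) =
      GrothendieckAddGroup.of (a * b) := by
  unfold completionMul
  rw [lift_of]
  exact lift_of _ b

/-- The Grothendieck group of a commutative semiring is a commutative ring. -/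
noncomputable instance completionCommRing : CommRing (GrothendieckAddGroup S) where
  __ := (inferInstance : AddCommGroup (GrothendieckAddGroup S))
  mul x y := completionMul x y
  one := GrothendieckAddGroup.of 1
  left_distrib x y z := map_add (completionMul x) y z
  right_distrib x y z := by
    change completionMul (x + y) z = completionMul x z + completionMul y z
    rw [map_add, AddMonoidHom.add_apply]
  zero_mul x := by
    change completionMul 0 x = 0
    rw [map_zero, AddMonoidHom.zero_apply]
  mul_zero x := map_zero (completionMul x)
  mul_assoc x y z := by
    change completionMul (completionMul x y) z = completionMul x (completionMul y z)
    obtain ⟨a, a', rfl⟩ := exists_sub x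
    obtain ⟨b, b', rfl⟩ := exists_sub y
    obtain ⟨c, c', rfl⟩ := exists_sub z
    simp only [map_sub, AddMonoidHom.sub_apply, completionMul_of, mul_assoc]
  one_mul x := by
    change completionMul (GrothendieckAddGroup.of 1) x = x
    obtain ⟨a, a', rfl⟩ := exists_sub x
    simp only [map_sub, completionMul_of, one_mul]
  mul_one x := by
    change completionMul x (GrothendieckAddGroup.of 1) = x
    obtain ⟨a, a', rfl⟩ := exists_sub x
    simp only [map_sub, AddMonoidHom.sub_apply, completionMul_of, mul_one]
  mul_comm x y := by
    change completionMul x y = completionMul y x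
    obtain ⟨a, a', rfl⟩ := exists_sub x
    obtain ⟨b, b', rfl⟩ := exists_sub y
    simp only [map_sub, AddMonoidHom.sub_apply, completionMul_of, mul_comm]
    abel

/-- A semiring homomorphism to a commutative ring extends to the ring completion. -/
noncomputable def completionLift {R : Type*} [CommRing R] (f : S →+* R) :
    GrothendieckAddGroup S →+* R where
  __ := GrothendieckAddGroup.lift f.toAddMonoidHom
  map_one' := (lift_of f.toAddMonoidHom 1).trans f.map_one
  map_mul' x y := by
    change GrothendieckAddGroup.lift f.toAddMonoidHom (completionMul x y) =
      GrothendieckAddGroup.lift f.toAddMonoidHom x * GrothendieckAddGroup.lift f.toAddMonoidHom y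
    obtain ⟨a, a', rfl⟩ := exists_sub x
    obtain ⟨b, b', rfl⟩ := exists_sub y
    simp only [map_sub, AddMonoidHom.sub_apply, completionMul_of, lift_of,
      RingHom.toAddMonoidHom_eq_coe, AddMonoidHom.coe_coe, map_mul]
    ring

end Completion

/-! ### Finite `G`-sets and the Burnside ring -/

/-- A finite `G`-set. -/
structure FinGSet (G : Type u) [Group G] where
  carrier : Type u
  [action : MulAction G carrier]
  [finite : Finite carrier]

attribute [instance] FinGSet.action FinGSet.finite

variable (G : Type u) [Group G]

/-- Two finite `G`-sets are identified when there is a `G`-equivariant bijection between them. -/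
instance FinGSet.setoid : Setoid (FinGSet G) where
  r X Y := ∃ e : X.carrier ≃ Y.carrier, ∀ (g : G) (x : X.carrier), e (g • x) = g • e x
  iseqv :=
    { refl := fun _ => ⟨Equiv.refl _, fun _ _ => rfl⟩
      symm := fun ⟨e, he⟩ => ⟨e.symm, fun g y => by rw [Equiv.symm_apply_eq, he]; simp⟩
      trans := fun ⟨e, he⟩ ⟨f, hf⟩ => ⟨e.trans f, fun g x => by simp [he, hf]⟩ }

/-- Isomorphism classes of finite `G`-sets. -/
def GSetClass : Type (u + 1) := Quotient (FinGSet.setoid G)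

/-- The disjoint union of two finite `G`-sets. -/
def FinGSet.sum {G : Type u} [Group G] (X Y : FinGSet G) : FinGSet G where
  carrier := X.carrier ⊕ Y.carrier

/-- The Cartesian product of two finite `G`-sets, with the diagonal action. -/
def FinGSet.prod {G : Type u} [Group G] (X Y : FinGSet G) : FinGSet G where
  carrier := X.carrier × Y.carrier

/-- The empty `G`-set. -/
def FinGSet.empty : FinGSet G where
  carrier := PEmpty
  action := { smul := fun _ x => x, one_smul := fun _ => rfl, mul_smul := fun _ _ _ => rfl }

/-- The one-point `G`-set. -/
def FinGSet.point : FinGSet G where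
  carrier := PUnit

instance : Add (GSetClass G) where
  add := Quotient.map₂ FinGSet.sum (by
    rintro X X' ⟨e, he⟩ Y Y' ⟨f, hf⟩
    refine ⟨Equiv.sumCongr e f, ?_⟩
    rintro g (x | y)
    · exact congrArg Sum.inl (he g x)
    · exact congrArg Sum.inr (hf g y))

instance : Mul (GSetClass G) where
  mul := Quotient.map₂ FinGSet.prod (by
    rintro X X' ⟨e, he⟩ Y Y' ⟨f, hf⟩
    refine ⟨Equiv.prodCongr e f, ?_⟩
    rintro g ⟨x, y⟩
    exact Prod.ext (he g x) (hf g y))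

instance : Zero (GSetClass G) where
  zero := Quotient.mk _ (FinGSet.empty G)

instance : One (GSetClass G) where
  one := Quotient.mk _ (FinGSet.point G)

/-- The semiring of isomorphism classes of finite `G`-sets: addition is disjoint union and
multiplication is the Cartesian product. -/
instance : CommSemiring (GSetClass G) where
  nsmul := nsmulRec
  add_assoc := by
    rintro ⟨X⟩ ⟨Y⟩ ⟨Z⟩
    refine Quotient.sound ⟨Equiv.sumAssoc _ _ _, ?_⟩
    rintro g ((x | y) | z) <;> rfl
  zero_add := by
    rintro ⟨X⟩
    refine Quotient.sound ⟨Equiv.emptySum PEmpty X.carrier, ?_⟩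
    rintro g (x | x)
    · exact x.elim
    · rfl
  add_zero := by
    rintro ⟨X⟩
    refine Quotient.sound ⟨Equiv.sumEmpty X.carrier PEmpty, ?_⟩
    rintro g (x | x)
    · rfl
    · exact x.elim
  add_comm := by
    rintro ⟨X⟩ ⟨Y⟩
    refine Quotient.sound ⟨Equiv.sumComm _ _, ?_⟩
    rintro g (x | y) <;> rfl
  left_distrib := by
    rintro ⟨X⟩ ⟨Y⟩ ⟨Z⟩
    refine Quotient.sound ⟨Equiv.prodSumDistrib _ _ _, ?_⟩
    rintro g ⟨x, y | z⟩ <;> rfl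
  right_distrib := by
    rintro ⟨X⟩ ⟨Y⟩ ⟨Z⟩
    refine Quotient.sound ⟨Equiv.sumProdDistrib _ _ _, ?_⟩
    rintro g ⟨x | y, z⟩ <;> rfl
  zero_mul := by
    rintro ⟨X⟩
    refine Quotient.sound ⟨Equiv.pemptyProd X.carrier, ?_⟩
    rintro g ⟨x, y⟩
    exact x.elim
  mul_zero := by
    rintro ⟨X⟩
    refine Quotient.sound ⟨Equiv.prodPEmpty X.carrier, ?_⟩
    rintro g ⟨x, y⟩
    exact y.elim
  mul_assoc := by
    rintro ⟨X⟩ ⟨Y⟩ ⟨Z⟩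
    refine Quotient.sound ⟨Equiv.prodAssoc _ _ _, ?_⟩
    rintro g ⟨⟨x, y⟩, z⟩
    rfl
  one_mul := by
    rintro ⟨X⟩
    refine Quotient.sound ⟨Equiv.punitProd X.carrier, ?_⟩
    rintro g ⟨x, y⟩
    rfl
  mul_one := by
    rintro ⟨X⟩
    refine Quotient.sound ⟨Equiv.prodPUnit X.carrier, ?_⟩
    rintro g ⟨x, y⟩
    rfl
  mul_comm := by
    rintro ⟨X⟩ ⟨Y⟩
    refine Quotient.sound ⟨Equiv.prodComm _ _, ?_⟩
    rintro g ⟨x, y⟩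
    rfl

/-- The Burnside ring `A(G)`: the ring of formal differences of isomorphism classes of finite
`G`-sets. -/
abbrev BurnsideRing : Type (u + 1) := Algebra.GrothendieckAddGroup (GSetClass G)

variable {G}

/-- The class in `A(G)` of a finite `G`-set. -/
noncomputable def classOf (X : FinGSet G) : BurnsideRing G :=
  Algebra.GrothendieckAddGroup.of (Quotient.mk _ X : GSetClass G)

/-- The number of fixed points `|X^I|` of a subgroup `I` on finite `G`-sets, as a semiring
homomorphism on isomorphism classes. -/
noncomputable def markSemiring (I : Subgroup G) : GSetClass G →+* ℤ where
  toFun := Quotient.lift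
    (fun X : FinGSet G => (Nat.card (MulAction.fixedPoints I X.carrier) : ℤ)) (by
      rintro X Y ⟨e, he⟩
      congr 1
      refine Nat.card_congr (e.subtypeEquiv fun x => ?_)
      simp only [MulAction.mem_fixedPoints, Subgroup.smul_def, ← he, EmbeddingLike.apply_eq_iff_eq])
  map_zero' := by
    have : IsEmpty (MulAction.fixedPoints I (FinGSet.empty G).carrier) := ⟨fun x => x.1.elim⟩
    change ((Nat.card (MulAction.fixedPoints I (FinGSet.empty G).carrier) : ℕ) : ℤ) = 0
    rw [Nat.card_of_isEmpty, Nat.cast_zero]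
  map_one' := by
    have h : MulAction.fixedPoints I (FinGSet.point G).carrier = Set.univ :=
      Set.eq_univ_of_forall fun _ _ => rfl
    have h' : Nat.card (FinGSet.point G).carrier = 1 := Nat.card_unique (α := PUnit)
    change ((Nat.card (MulAction.fixedPoints I (FinGSet.point G).carrier) : ℕ) : ℤ) = 1
    rw [h, Nat.card_univ, h', Nat.cast_one]
  map_add' := by
    rintro ⟨X⟩ ⟨Y⟩
    have e : MulAction.fixedPoints I (X.sum Y).carrier ≃
        MulAction.fixedPoints I X.carrier ⊕ MulAction.fixedPoints I Y.carrier :=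
      Equiv.trans Equiv.subtypeSum (Equiv.sumCongr
        (Equiv.subtypeEquivRight fun _ => forall_congr' fun _ => Sum.inl_injective.eq_iff)
        (Equiv.subtypeEquivRight fun _ => forall_congr' fun _ => Sum.inr_injective.eq_iff))
    change ((Nat.card (MulAction.fixedPoints I (X.sum Y).carrier) : ℕ) : ℤ) =
      (Nat.card (MulAction.fixedPoints I X.carrier) : ℤ) +
        (Nat.card (MulAction.fixedPoints I Y.carrier) : ℤ)
    rw [Nat.card_congr e, Nat.card_sum, Nat.cast_add]
  map_mul' := by
    rintro ⟨X⟩ ⟨Y⟩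
    have e : MulAction.fixedPoints I (X.prod Y).carrier ≃
        MulAction.fixedPoints I X.carrier × MulAction.fixedPoints I Y.carrier :=
      { toFun := fun x => (⟨x.1.1, fun i => congrArg Prod.fst (x.2 i)⟩,
          ⟨x.1.2, fun i => congrArg Prod.snd (x.2 i)⟩)
        invFun := fun y => ⟨(y.1.1, y.2.1), fun i => Prod.ext (y.1.2 i) (y.2.2 i)⟩
        left_inv := fun _ => rfl
        right_inv := fun _ => rfl }
    change ((Nat.card (MulAction.fixedPoints I (X.prod Y).carrier) : ℕ) : ℤ) =
      (Nat.card (MulAction.fixedPoints I X.carrier) : ℤ) *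
        (Nat.card (MulAction.fixedPoints I Y.carrier) : ℤ)
    rw [Nat.card_congr e, Nat.card_prod, Nat.cast_mul]

/-- The mark `φ_G^I : A(G) → ℤ`, the ring homomorphism with `φ_G^I(X) = |X^I|` for every finite
`G`-set `X`. -/
noncomputable def mark (I : Subgroup G) : BurnsideRing G →+* ℤ :=
  completionLift (markSemiring I)

theorem mark_classOf (I : Subgroup G) (X : FinGSet G) :
    mark I (classOf X) = Nat.card (MulAction.fixedPoints I X.carrier) :=
  lift_of (markSemiring I).toAddMonoidHom _

/-- The mark modulo `p`, `φ_{G,p}^I : A(G) → ℤ/pℤ`. For `p = 0` it is `φ_G^I` itself. -/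
noncomputable def markMod (p : ℕ) (I : Subgroup G) : BurnsideRing G →+* ZMod p :=
  (Int.castRingHom (ZMod p)).comp (mark I)

/-! ### The ideals `𝔭_{C,p}` of the Burnside Tambara functor -/

/-- `I` is subconjugate to `C` in `G`: some conjugate `I^g = g⁻¹ I g` is contained in `C`. -/
def Subconj (I C : Subgroup G) : Prop :=
  ∃ g : G, ∀ x ∈ I, g⁻¹ * x * g ∈ C

/-- The family `𝔭_{C,p}` of ideals `𝔭_{C,p}(G/H)` of the rings `A_G(G/H) = A(H)`, for `H ≤ G`:
the intersection of the kernels of `φ_{H,p}^I` over all `I ≤ H` subconjugate in `G` to `C`.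
Families of ideals are compared levelwise (the order of a product of ordered sets). -/
noncomputable def primeIdeal (C : Subgroup G) (p : ℕ) :
    (H : Subgroup G) → Ideal (BurnsideRing H) :=
  fun H => ⨅ (I : Subgroup G) (_ : I ≤ H) (_ : Subconj I C),
    RingHom.ker (markMod p (I.subgroupOf H))

/-- `O^p(H)`: the intersection of all normal subgroups of `H` of index a power of `p`, as a
subgroup of `G`. -/
def pResidual (p : ℕ) (H : Subgroup G) : Subgroup G :=
  (sInf {I : Subgroup H | I.Normal ∧ ∃ n : ℕ, I.index = p ^ n}).map H.subtype

end BurnsideTambara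

namespace BurnsideTambara

universe v

/-! As $G$ is abelian, subconjugacy is containment: the ideal of $C$ at level $L$ asks that the
marks at all $I \le L \cap C$ vanish mod $p$. Shrinking $C$ thus enlarges the ideal. Sufficiency in
(iii): the $p$-group $I/O^p(I)$ acts on $X^{O^p(I)}$ with fixed points $X^I$, so the marks at $I$
and $O^p(I)$ agree mod $p$, and only $O^p(K) \le H$ is needed. Necessity: for $L \le K$ with $L
\not\le H$, the element $[L/(H\cap L)] - [L : H\cap L]$ has mark zero at every subgroup of $H\cap
L$, but mark $-[L : H\cap L]$ at $L$. In characteristic $0$ take $L = K$. For a prime $p$ take $L =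
O^p(K)$, whose order is prime to $p$, so that the index survives mod $p$ (`le_of_primeIdeal_le`,
`coprime_card_pResidual`). Different characteristics are separated by the integer $p$, viewed in the
Burnside ring. -/

theorem subconj_iff_le {G : Type v} [CommGroup G] {I C : Subgroup G} : Subconj I C ↔ I ≤ C := by
  simp [Subconj, SetLike.le_def]

theorem mem_primeIdeal {G : Type v} [CommGroup G] {C : Subgroup G} {p : ℕ} {L : Subgroup G}
    {x : BurnsideRing L} :
    x ∈ primeIdeal C p L ↔
      ∀ I : Subgroup G, I ≤ L → I ≤ C → markMod p (I.subgroupOf L) x = 0 := by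
  simp only [primeIdeal, Ideal.mem_iInf, subconj_iff_le, RingHom.mem_ker]

theorem markMod_apply {A : Type v} [Group A] (p : ℕ) (I : Subgroup A) (x : BurnsideRing A) :
    markMod p I x = ((mark I x : ℤ) : ZMod p) := rfl

theorem markMod_natCast {A : Type v} [Group A] (p : ℕ) (I : Subgroup A) (n : ℕ) :
    markMod p I (n : BurnsideRing A) = (n : ZMod p) := map_natCast _ n

/-! ### Marks modulo $p$ along $p$-group quotients -/

/-- For a `p`-group quotient `I / J`, a finite set has, modulo `p`, as many points fixed by `I`
as by `J`. -/
theorem card_fixedPoints_modEq {A : Type v} [CommGroup A] {X : Type v} [MulAction A X] [Finite X]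
    {p : ℕ} [Fact p.Prime] {I J : Subgroup A} (hJI : J ≤ I) {m : ℕ}
    (hpow : ∀ x ∈ I, x ^ p ^ m ∈ J) :
    Nat.card (MulAction.fixedPoints I X) ≡ Nat.card (MulAction.fixedPoints J X) [MOD p] := by
  -- Commutativity makes $X^J$ stable under all of $A$.
  let act : MulAction A (MulAction.fixedPoints J X) :=
    { smul := fun a x => ⟨a • x.1, fun j => by
        have := x.2 j
        rw [Subgroup.smul_def] at this ⊢
        rw [smul_smul, mul_comm, ← smul_smul, this]⟩
      one_smul := fun x => Subtype.ext (one_smul A x.1)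
      mul_smul := fun a b x => Subtype.ext (mul_smul a b x.1) }
  have hsmul : ∀ (a : A) (x : MulAction.fixedPoints J X), (a • x).1 = a • x.1 := fun _ _ => rfl
  let P := I.map (MulAction.toPermHom A (MulAction.fixedPoints J X))
  have hP : IsPGroup p P := by
    rintro ⟨_, a, ha, rfl⟩
    refine ⟨m, Subtype.ext ?_⟩
    rw [SubmonoidClass.coe_pow, ← map_pow]
    refine Equiv.ext fun x => Subtype.ext ?_
    exact x.2 ⟨_, hpow a ha⟩
  have e : MulAction.fixedPoints P (MulAction.fixedPoints J X) ≃ MulAction.fixedPoints I X :=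
    { toFun := fun x => ⟨x.1.1, fun i => congrArg Subtype.val (x.2 ⟨_, i.1, i.2, rfl⟩)⟩
      invFun := fun x => ⟨⟨x.1, fun j => x.2 ⟨j.1, hJI j.2⟩⟩, by
        rintro ⟨_, a, ha, rfl⟩
        exact Subtype.ext (x.2 ⟨a, ha⟩)⟩
      left_inv := fun _ => rfl
      right_inv := fun _ => rfl }
  have := hP.card_modEq_card_fixedPoints (MulAction.fixedPoints J X)
  rw [Nat.card_congr e] at this
  exact this.symm

theorem markMod_eq_of_pow_mem {A : Type v} [CommGroup A] {p : ℕ} [Fact p.Prime]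
    {I J : Subgroup A} (hJI : J ≤ I) {m : ℕ} (hpow : ∀ x ∈ I, x ^ p ^ m ∈ J)
    (x : BurnsideRing A) : markMod p I x = markMod p J x := by
  have key : ∀ a : GSetClass A, markMod p I (Algebra.GrothendieckAddGroup.of a) =
      markMod p J (Algebra.GrothendieckAddGroup.of a) := by
    rintro ⟨X⟩
    change markMod p I (classOf X) = markMod p J (classOf X)
    rw [markMod_apply, markMod_apply, mark_classOf, mark_classOf, Int.cast_natCast,
      Int.cast_natCast, ZMod.natCast_eq_natCast_iff]
    exact card_fixedPoints_modEq hJI hpow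
  obtain ⟨a, b, rfl⟩ := exists_sub x
  rw [map_sub, map_sub, key, key]

/-! ### Test elements and basic containments -/

/-- The finite `A`-set `A ⧸ N`. -/
def cosetSet {A : Type v} [Group A] [Finite A] (N : Subgroup A) : FinGSet A where
  carrier := A ⧸ N

/-- The element `[A ⧸ N] - [A : N]` of the Burnside ring. -/
noncomputable def cosetSubIndex {A : Type v} [Group A] [Finite A] (N : Subgroup A) :
    BurnsideRing A :=
  classOf (cosetSet N) - (N.index : BurnsideRing A)

/-- In an abelian group, any $I \le N$ acts trivially on $A/N$. -/
theorem mark_cosetSubIndex_of_le {A : Type v} [CommGroup A] [Finite A] {I N : Subgroup A}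
    (h : I ≤ N) : mark I (cosetSubIndex N) = 0 := by
  have hfix : MulAction.fixedPoints I (A ⧸ N) = Set.univ := by
    refine Set.eq_univ_of_forall fun x i => ?_
    induction x using QuotientGroup.induction_on with
    | H a =>
      refine QuotientGroup.eq.2 ?_
      change (i.1 * a)⁻¹ * a ∈ N
      rw [mul_inv_rev, mul_comm a⁻¹, inv_mul_cancel_right]
      exact N.inv_mem (h i.2)
  rw [cosetSubIndex, map_sub, mark_classOf, map_natCast]
  change (Nat.card (MulAction.fixedPoints I (A ⧸ N)) : ℤ) - _ = 0
  rw [hfix, Nat.card_univ, Subgroup.index, sub_self]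

theorem mark_top_cosetSubIndex {A : Type v} [Group A] [Finite A] {N : Subgroup A}
    (h : N ≠ ⊤) : mark ⊤ (cosetSubIndex N) = -(N.index : ℤ) := by
  have hfix : IsEmpty (MulAction.fixedPoints (⊤ : Subgroup A) (A ⧸ N)) := by
    refine ⟨fun ⟨x, hx⟩ => h ?_⟩
    induction x using QuotientGroup.induction_on with
    | H a =>
      refine eq_top_iff.2 fun b _ => ?_
      -- The acting element is chosen so that its fixing $aN$ says exactly $b \in N$.
      have := QuotientGroup.eq.1 (hx ⟨a * b⁻¹ * a⁻¹, trivial⟩)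
      change (a * b⁻¹ * a⁻¹ * a)⁻¹ * a ∈ N at this
      simpa using this
  rw [cosetSubIndex, map_sub, mark_classOf, map_natCast]
  change (Nat.card (MulAction.fixedPoints (⊤ : Subgroup A) (A ⧸ N)) : ℤ) - _ = _
  rw [Nat.card_of_isEmpty, Nat.cast_zero, zero_sub]

/-- A containment of ideals at the level of `L ≤ K` forces `L ≤ H` unless the index vanishes
in the residue ring. -/
theorem le_of_primeIdeal_le {G : Type v} [CommGroup G] [Finite G] {H K L : Subgroup G} {p : ℕ}
    (h : primeIdeal H p ≤ primeIdeal K p) (hL : L ≤ K)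
    (hidx : ((H.relIndex L : ℕ) : ZMod p) ≠ 0) : L ≤ H := by
  by_contra hLH
  have hmem : cosetSubIndex (H.subgroupOf L) ∈ primeIdeal H p L := by
    refine mem_primeIdeal.2 fun I _ hIH => ?_
    have hle : I.subgroupOf L ≤ H.subgroupOf L := Subgroup.comap_mono hIH
    rw [markMod_apply, mark_cosetSubIndex_of_le hle, Int.cast_zero]
  have := mem_primeIdeal.1 (h L hmem) L le_rfl hL
  rw [Subgroup.subgroupOf_self, markMod_apply,
    mark_top_cosetSubIndex (mt Subgroup.subgroupOf_eq_top.1 hLH), Int.cast_neg,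
    Int.cast_natCast, neg_eq_zero] at this
  exact hidx this

/-- All marks of an integer equal that integer, and the trivial subgroup always occurs in the
intersection. -/
theorem natCast_mem_primeIdeal {G : Type v} [CommGroup G] (C : Subgroup G) (p q : ℕ)
    (L : Subgroup G) : (q : BurnsideRing L) ∈ primeIdeal C p L ↔ (q : ZMod p) = 0 := by
  simp only [mem_primeIdeal, markMod_natCast]
  exact ⟨fun h => h ⊥ bot_le bot_le, fun h _ _ _ => h⟩

theorem primeIdeal_anti {G : Type v} [CommGroup G] {H K : Subgroup G} (p : ℕ) (h : K ≤ H) :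
    primeIdeal H p ≤ primeIdeal K p := fun _ _ hx =>
  mem_primeIdeal.2 fun I hIL hIK => mem_primeIdeal.1 hx I hIL (hIK.trans h)

theorem primeIdeal_zero_le {G : Type v} [CommGroup G] (H : Subgroup G) (p : ℕ) :
    primeIdeal H 0 ≤ primeIdeal H p := fun _ x hx =>
  mem_primeIdeal.2 fun I hIL hIH => by
    have h0 : mark _ x = 0 := mem_primeIdeal.1 hx I hIL hIH
    rw [markMod_apply, h0, Int.cast_zero]

/-! ### The subgroup $O^p(H)$ of a finite abelian group -/

/-- In a finite abelian group `O^p(H)` consists of the `p ^ m`-th powers of elements of `H`, for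
all large enough `m`. -/
theorem pResidual_eq_map_pow {G : Type v} [CommGroup G] [Finite G] {p : ℕ} (hp : p.Prime)
    (H : Subgroup G) {m : ℕ} (hm : Nat.card G ≤ m) :
    pResidual p H = H.map (powMonoidHom (p ^ m)) := by
  have := Fact.mk hp
  apply le_antisymm
  · have hle : (H.map (powMonoidHom (p ^ m))).subgroupOf H ∈
        {I : Subgroup H | I.Normal ∧ ∃ n : ℕ, I.index = p ^ n} := by
      refine ⟨inferInstance, ?_⟩
      refine (IsPGroup.iff_card (p := p) (G := H ⧸ _)).1 fun x => ⟨m, ?_⟩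
      induction x using QuotientGroup.induction_on with
      | H a =>
        rw [← QuotientGroup.mk_pow, QuotientGroup.eq_one_iff]
        exact ⟨a, a.2, rfl⟩
    refine (Subgroup.map_mono (sInf_le hle)).trans ?_
    rw [Subgroup.subgroupOf_map_subtype]
    exact inf_le_left
  · rintro _ ⟨x, hx, rfl⟩
    refine ⟨⟨x, hx⟩ ^ p ^ m, ?_, rfl⟩
    -- The bound $n < p^n = [H : I] \le |G| \le m$ lets $x^{p^m}$ be a power of $x^{[H:I]} \in I$.
    refine Subgroup.mem_sInf.2 fun I ⟨_, n, hn⟩ => ?_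
    have hnm : n ≤ m := by
      refine le_trans (Nat.lt_pow_self hp.one_lt).le (le_trans ?_ hm)
      rw [← hn]
      exact (Nat.le_of_dvd Nat.card_pos I.index_dvd_card).trans (Subgroup.card_le_card_group H)
    rw [← Nat.add_sub_cancel' hnm, pow_add, pow_mul, ← hn]
    exact I.pow_mem (I.pow_index_mem _) _

theorem pResidual_le {G : Type v} [Group G] (p : ℕ) (H : Subgroup G) :
    pResidual p H ≤ H := Subgroup.map_subtype_le _

theorem pResidual_mono {G : Type v} [CommGroup G] [Finite G] {p : ℕ} (hp : p.Prime)
    {H K : Subgroup G} (h : H ≤ K) : pResidual p H ≤ pResidual p K := by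
  rw [pResidual_eq_map_pow hp H le_rfl, pResidual_eq_map_pow hp K le_rfl]
  exact Subgroup.map_mono h

/-- Two successive $p^{|G|}$-th powers give exponent $p^{2|G|}$, which computes the same $O^p(H)$.
-/
theorem pResidual_idem {G : Type v} [CommGroup G] [Finite G] {p : ℕ} (hp : p.Prime)
    (H : Subgroup G) : pResidual p (pResidual p H) = pResidual p H := by
  rw [pResidual_eq_map_pow hp (pResidual p H) le_rfl, pResidual_eq_map_pow hp H le_rfl,
    Subgroup.map_map, ← pResidual_eq_map_pow hp H le_rfl,
    pResidual_eq_map_pow hp H (Nat.le_add_left (Nat.card G) (Nat.card G))]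
  congr 1
  ext x
  simp [pow_add, pow_mul]

/-- By idempotence the $p^{|G|}$-th power map is surjective on the finite group $O^p(H)$, hence
injective, which excludes elements of order $p$. -/
theorem coprime_card_pResidual {G : Type v} [CommGroup G] [Finite G] {p : ℕ} (hp : p.Prime)
    (H : Subgroup G) : ¬ p ∣ Nat.card (pResidual p H) := by
  have := Fact.mk hp
  intro hdvd
  obtain ⟨J, hJ⟩ : ∃ J, J = pResidual p H := ⟨_, rfl⟩
  rw [← hJ] at hdvd
  obtain ⟨y, hy⟩ := exists_prime_orderOf_dvd_card' p hdvd
  have hidem : J.map (powMonoidHom (p ^ Nat.card G)) = J := by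
    rw [← pResidual_eq_map_pow hp J le_rfl, hJ, pResidual_idem hp H]
  have hsurj : Function.Surjective fun x : J => x ^ p ^ Nat.card G := by
    rintro ⟨z, hz⟩
    rw [← hidem] at hz
    obtain ⟨x, hx, rfl⟩ := hz
    exact ⟨⟨x, hx⟩, rfl⟩
  have hy1 : y = 1 := by
    refine Finite.injective_iff_surjective.2 hsurj ?_
    rw [one_pow, ← orderOf_dvd_iff_pow_eq_one, hy]
    exact dvd_pow_self p Nat.card_pos.ne'
  rw [hy1, orderOf_one] at hy
  exact hp.one_lt.ne hy

/-! ### Containments in characteristic $p$ -/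

theorem primeIdeal_le_of_pResidual_le {G : Type v} [CommGroup G] [Finite G] {p : ℕ}
    (hp : p.Prime) {H K : Subgroup G} (h : pResidual p K ≤ H) :
    primeIdeal H p ≤ primeIdeal K p := fun L x hx => by
  have := Fact.mk hp
  refine mem_primeIdeal.2 fun I hIL hIK => ?_
  have hpow : ∀ y ∈ I.subgroupOf L, y ^ p ^ Nat.card G ∈ (pResidual p I).subgroupOf L := by
    intro y hy
    rw [pResidual_eq_map_pow hp I le_rfl]
    exact ⟨y, hy, rfl⟩
  have hle : (pResidual p I).subgroupOf L ≤ I.subgroupOf L :=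
    Subgroup.comap_mono (pResidual_le p I)
  rw [markMod_eq_of_pow_mem hle hpow]
  exact mem_primeIdeal.1 hx _ ((pResidual_le p I).trans hIL) ((pResidual_mono hp hIK).trans h)

theorem pResidual_le_of_primeIdeal_le {G : Type v} [CommGroup G] [Finite G] {p : ℕ}
    (hp : p.Prime) {H K : Subgroup G} (h : primeIdeal H p ≤ primeIdeal K p) :
    pResidual p K ≤ pResidual p H := by
  rw [← pResidual_idem hp K]
  -- The test element at level $O^p(K)$ gives $O^p(K) \le H$; by idempotence, applying $O^p$
  -- finishes.
  refine pResidual_mono hp (le_of_primeIdeal_le h (pResidual_le p K) fun h0 => ?_)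
  exact coprime_card_pResidual hp K
    (((ZMod.natCast_eq_zero_iff _ _).1 h0).trans (Subgroup.index_dvd_card _))

end BurnsideTambara

theorem theorem3p8 {G : Type*} [CommGroup G] [Finite G] (H K : Subgroup G) (p q : ℕ)
    (hp : p.Prime) (hq : q.Prime) :
    (BurnsideTambara.primeIdeal H 0 ≤ BurnsideTambara.primeIdeal K 0 ↔ K ≤ H) ∧
    (BurnsideTambara.primeIdeal H 0 < BurnsideTambara.primeIdeal H p ∧
      ¬ BurnsideTambara.primeIdeal H p ≤ BurnsideTambara.primeIdeal K 0) ∧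
    (BurnsideTambara.primeIdeal H p ≤ BurnsideTambara.primeIdeal K q ↔
      p = q ∧ BurnsideTambara.pResidual p K ≤ BurnsideTambara.pResidual p H) := by
  -- Already at the level of the trivial subgroup, the integer $p$ forces $p = 0$ in $\mathbb Z/r$.
  have hcast : ∀ {C : Subgroup G} {r : ℕ},
      BurnsideTambara.primeIdeal H p ≤ BurnsideTambara.primeIdeal C r → (p : ZMod r) = 0 :=
    fun {C r} h => (BurnsideTambara.natCast_mem_primeIdeal C r p ⊥).1
      (h ⊥ ((BurnsideTambara.natCast_mem_primeIdeal H p p ⊥).2 (ZMod.natCast_self p)))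
  have hzero : ∀ C : Subgroup G, ¬ BurnsideTambara.primeIdeal H p ≤
      BurnsideTambara.primeIdeal C 0 := fun C h =>
    hp.ne_zero (Nat.cast_eq_zero (R := ℤ).1 (hcast h))
  refine ⟨⟨fun h => ?_, BurnsideTambara.primeIdeal_anti 0⟩,
    ⟨lt_of_le_not_ge (BurnsideTambara.primeIdeal_zero_le H p) (hzero H), hzero K⟩,
    fun h => ?_, ?_⟩
  · refine BurnsideTambara.le_of_primeIdeal_le h le_rfl fun h0 => ?_
    exact Subgroup.index_ne_zero_of_finite (Nat.cast_eq_zero (R := ℤ).1 h0)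
  · obtain rfl : p = q :=
      ((Nat.prime_dvd_prime_iff_eq hq hp).1 ((ZMod.natCast_eq_zero_iff _ _).1 (hcast h))).symm
    exact ⟨rfl, BurnsideTambara.pResidual_le_of_primeIdeal_le hp h⟩
  · rintro ⟨rfl, h⟩
    exact BurnsideTambara.primeIdeal_le_of_pResidual_le hp
      (h.trans (BurnsideTambara.pResidual_le p H))
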